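/- Let $\mathcal A$ be a complex Banach algebra with identity. An element $a$ of a unital ring $R$ is called quasinilpotent if $1+ax$ is invertible for every $x\in R$ with $xa=ax$; it is called g-Drazin invertible if there is $b\in R$ with $ab=ba$, $b=bab$ and $a-a^2b$ quasinilpotent. If $R$ is a complex Banach algebra (such as $\mathcal A$ or the algebra $M_2(\mathcal A)$ of $2\times 2$ matrices over $\mathcal A$), such a $b$ is unique; it is denoted by $a^d$, and $a^\pi=1-aa^d$. Let $A,B,C,D\in\mathcal A$, where $A$ and $D$ are g-Drazin invertible, and let $\lambda\in\mathbb C$ be nonzero. Put $$M=\begin{pmatrix}A&B\\C&D\end{pmatrix},\qquad P=\begin{pmatrix}A&0\\0&D\end{pmatrix},\qquad Q=\begin{pmatrix}0&B\\C&0\end{pmatrix}$$ in $M_2(\mathcal A)$. If $$BD=\lambda ABD^\pi,\qquad CA=\lambda DCA^\pi,\qquad BC=0,$$ then $P$ and $M$ are g-Drazin invertible in $M_2(\mathcal A)$, the series below converges (unconditionally) in $M_2(\mathcal A)$, and $$M^d=\begin{pmatrix}A^d&0\\0&D^d\end{pmatrix}+\sum_{n=0}^{\infty}(P^d)^{n+2}QM^n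 .$$ -/

import Mathlib

/-- `a` is quasinilpotent: `1 + a x` is invertible for every `x` in the commutant of `a`. -/
def IsQuasinilpotent {R : Type*} [Ring R] (a : R) : Prop :=
  ∀ x : R, x * a = a * x → IsUnit (1 + a * x)

/-- `b` is a generalized Drazin inverse of `a`: `b` lies in the commutant of `a`,
`b = b a b`, and `a - a² b` is quasinilpotent. -/
structure IsGDrazinInverse {R : Type*} [Ring R] (a b : R) : Prop where
  comm : b * a = a * b
  inner : b = b * a * b
  qnil : IsQuasinilpotent (a - a ^ 2 * b)

/-- `a` is g-Drazin invertible. -/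
def IsGDrazinInvertible {R : Type*} [Ring R] (a : R) : Prop :=
  ∃ b : R, IsGDrazinInverse a b

open Classical in
/-- The g-Drazin inverse of `a`, with value `0` if `a` is not g-Drazin invertible.
In a complex Banach algebra it does not depend on the choice, see `IsGDrazinInverse.unique`. -/
noncomputable def gDrazinInv {R : Type*} [Ring R] (a : R) : R :=
  if h : IsGDrazinInvertible a then h.choose else 0

/-- The spectral idempotent `1 - a a^d` of `a`. -/
noncomputable def spectralIdem {R : Type*} [Ring R] (a : R) : R :=
  1 - a * gDrazinInv a

theorem isGDrazinInverse_gDrazinInv {R : Type*} [Ring R] {a : R} (h : IsGDrazinInvertible a) :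
    IsGDrazinInverse a (gDrazinInv a) := by
  rw [gDrazinInv, dif_pos h]
  exact h.choose_spec

open Filter Topology in
/-- If `c` is quasinilpotent, then `rⁿ ‖cⁿ‖` tends to zero for every real `r ≥ 0`. -/
theorem IsQuasinilpotent.tendsto {R : Type*} [NormedRing R] [NormedAlgebra ℂ R]
    [CompleteSpace R] {c : R} (hc : IsQuasinilpotent c) (r : ℝ) (hr : 0 ≤ r) :
    Tendsto (fun n : ℕ => r ^ n * ‖c ^ n‖) atTop (𝓝 0) := by
  have hs : spectralRadius ℂ c = 0 := by
    rw [spectralRadius]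
    simp only [ENNReal.iSup_eq_zero, ENNReal.coe_eq_zero, nnnorm_eq_zero]
    intro k hk
    by_contra hk0
    apply hk
    have h := hc (algebraMap ℂ R (-k⁻¹)) (Algebra.commutes _ _)
    rw [spectrum.mem_resolventSet_iff]
    have h2 := (((Units.mk0 k hk0).isUnit).map (algebraMap ℂ R)).mul h
    convert h2 using 1
    rw [mul_add, mul_one, ← Algebra.commutes (-k⁻¹) c, ← mul_assoc, Units.val_mk0,
      ← map_mul, mul_neg, mul_inv_cancel₀ hk0, map_neg, map_one, neg_one_mul, sub_eq_add_neg]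
  have ht := spectrum.pow_nnnorm_pow_one_div_tendsto_nhds_spectralRadius c
  rw [hs] at ht
  obtain ⟨e, he⟩ : ∃ e : NNReal, (e : ℝ) = 1 / (2 * (r + 1)) :=
    ⟨⟨1 / (2 * (r + 1)), by positivity⟩, rfl⟩
  have hepos : 0 < e := by
    rw [← NNReal.coe_pos, he]
    positivity
  have hev := ht.eventually (eventually_lt_nhds (show (0 : ENNReal) < (e : ENNReal) by exact_mod_cast hepos))
  have hgeo : Tendsto (fun n : ℕ => (1 / 2 : ℝ) ^ n) atTop (𝓝 0) :=
    tendsto_pow_atTop_nhds_zero_of_lt_one (by norm_num) (by norm_num)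
  refine squeeze_zero' (Eventually.of_forall fun n => by positivity) ?_ hgeo
  filter_upwards [hev, eventually_gt_atTop 0] with n hn hn0
  have hn' : (‖c ^ n‖₊ : ENNReal) ≤ (e : ENNReal) ^ n := by
    have := ENNReal.rpow_le_rpow hn.le (Nat.cast_nonneg n : (0 : ℝ) ≤ n)
    rwa [← ENNReal.rpow_mul, one_div, inv_mul_cancel₀ (by positivity), ENNReal.rpow_one,
      ENNReal.rpow_natCast] at this
  have hn2 : ‖c ^ n‖ ≤ (1 / (2 * (r + 1))) ^ n := by
    have h3 : ‖c ^ n‖₊ ≤ e ^ n := by exact_mod_cast hn'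
    rw [← he]
    exact_mod_cast h3
  calc r ^ n * ‖c ^ n‖ ≤ r ^ n * (1 / (2 * (r + 1))) ^ n := by gcongr
    _ = (r * (1 / (2 * (r + 1)))) ^ n := (mul_pow _ _ _).symm
    _ ≤ (1 / 2) ^ n := by
      gcongr
      rw [mul_one_div, div_le_div_iff₀ (by positivity) (by norm_num)]
      linarith

/-- In a complex Banach algebra the g-Drazin inverse is unique. -/
theorem IsGDrazinInverse.unique {R : Type*} [NormedRing R] [NormedAlgebra ℂ R]
    [CompleteSpace R] {a b c : R} (hb : IsGDrazinInverse a b) (hc : IsGDrazinInverse a c) :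
    b = c := by
  have key : ∀ x y : R, IsGDrazinInverse a x → IsGDrazinInverse a y →
      (y * a) * (1 - x * a) = 0 ∧ (1 - x * a) * (a * y) = 0 := by
    intro x y hx hy
    have hxa : Commute x a := hx.comm
    have hya : Commute y a := hy.comm
    have hp : IsIdempotentElem (1 - x * a) := by
      apply IsIdempotentElem.one_sub
      change x * a * (x * a) = x * a
      rw [← mul_assoc, ← hx.inner]
    have hpa : Commute (1 - x * a) a :=
      (Commute.one_left a).sub_left (hxa.mul_left (Commute.refl a))
    have hya' : IsIdempotentElem (y * a) := by
      change y * a * (y * a) = y * a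
      rw [← mul_assoc, ← hy.inner]
    have hq : a - a ^ 2 * x = a * (1 - x * a) := by
      rw [mul_sub, mul_one, pow_two, hxa.eq, mul_assoc]
    have ht := (hq ▸ hx.qnil).tendsto ‖y‖ (norm_nonneg _)
    constructor
    · refine norm_le_zero_iff.mp (ge_of_tendsto ht ?_)
      filter_upwards [Filter.eventually_gt_atTop 0] with n hn
      have : y * a * (1 - x * a) = y ^ n * (a * (1 - x * a)) ^ n := by
        rw [hpa.symm.mul_pow, hp.pow_eq hn.ne', ← mul_assoc, ← hya.mul_pow,
          hya'.pow_eq hn.ne']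
      rw [this]
      refine (norm_mul_le _ _).trans ?_
      gcongr
      exact norm_pow_le' y hn
    · refine norm_le_zero_iff.mp (ge_of_tendsto ht ?_)
      filter_upwards [Filter.eventually_gt_atTop 0] with n hn
      have : (1 - x * a) * (a * y) = (a * (1 - x * a)) ^ n * y ^ n := by
        rw [← hpa.eq, hpa.mul_pow, hp.pow_eq hn.ne', mul_assoc, ← hya.symm.mul_pow,
          ← hya.eq, hya'.pow_eq hn.ne']
      rw [this, mul_comm (‖y‖ ^ n)]
      refine (norm_mul_le _ _).trans ?_
      gcongr
      exact norm_pow_le' y hn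
  have h1 := (key b c hb hc).2
  have h2 := (key c b hc hb).1
  rw [sub_mul, one_mul, sub_eq_zero] at h1
  rw [mul_sub, mul_one, sub_eq_zero] at h2
  have h3 : b * a = c * a := by
    rw [h2, ← mul_assoc, mul_assoc (b * a), hc.comm, ← h1]
  calc b = b * (a * b) := by rw [← mul_assoc]; exact hb.inner
    _ = c * a * b := by rw [← mul_assoc, h3]
    _ = c * (c * a) := by rw [mul_assoc, ← hb.comm, h3]
    _ = c := by rw [hc.comm, ← mul_assoc]; exact hc.inner.symm

/-! Write `M = P + Q` and `p = P^d`. The hypotheses on the entries say `Q P = λ P Q P^π` and `Q ^ 3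
= 0`, so the claim is an additive formula in a Banach algebra. The relation forces `Q p = 0`, hence
`Q = Q f` with `f = P^π`, and `f M f = f M`. Thus `f M ^ n = f (f M) ^ n`, where `f M = f P + f Q`
with `f P` quasinilpotent, `f Q` nilpotent, and the two commuting up to the scalar `λ`. Expanding
powers shows that `f M` is quasinilpotent. This decay makes `T = ∑ p ^ (n + 1) Q M ^ n` converge,
and it makes `M (1 - M b)` quasinilpotent for `b = p + p T`. The remaining identities are algebra
from `T = p Q + p T M` and `T p = 0`; uniqueness then gives the formula. -/

open Filter Topology

/-- An element whose powers decay faster than every geometric sequence is quasinilpotent. -/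
theorem IsQuasinilpotent.of_tendsto {R : Type*} [NormedRing R] [CompleteSpace R] {c : R}
    (h : ∀ r : ℝ, 0 ≤ r → Tendsto (fun n : ℕ => r ^ n * ‖c ^ n‖) atTop (𝓝 0)) :
    IsQuasinilpotent c := by
  intro x hx
  have hcomm : Commute c x := (show Commute x c from hx).symm
  have hev := (h ‖x‖ (norm_nonneg x)).eventually (eventually_lt_nhds (zero_lt_one' ℝ))
  obtain ⟨n, hn, hn0⟩ := (hev.and (eventually_gt_atTop 0)).exists
  have hlt : ‖(-(c * x)) ^ n‖ < 1 := by
    refine lt_of_le_of_lt ?_ hn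
    rw [neg_pow, hcomm.mul_pow, hcomm.pow_pow n n |>.eq]
    rcases neg_one_pow_eq_or R n with h1 | h1 <;> rw [h1]
    · rw [one_mul]
      exact (norm_mul_le _ _).trans (by gcongr; exact norm_pow_le' x hn0)
    · rw [neg_one_mul, norm_neg]
      exact (norm_mul_le _ _).trans (by gcongr; exact norm_pow_le' x hn0)
  have hu : IsUnit (1 - (-(c * x)) ^ n) := isUnit_one_sub_of_norm_lt_one hlt
  -- `1 + c x` is a factor of this unit, and the cofactor commutes with it, so it is itself a unit.
  rw [← mul_neg_geom_sum] at hu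
  have hc : Commute (1 - (-(c * x))) (∑ i ∈ Finset.range n, (-(c * x)) ^ i) :=
    Commute.sum_right _ _ _ fun i _ =>
      ((Commute.one_left _).sub_left (Commute.refl _)).pow_right i
  have := (hc.isUnit_mul_iff.mp hu).1
  rwa [sub_neg_eq_add] at this

/-! ### Sums of elements commuting up to a scalar -/

/-- The powers of `p + q` when `q p = l p q` and `q ^ 3 = 0`. -/
theorem exists_add_pow_eq_of_mul_eq_smul {R : Type*} [Ring R] [Algebra ℂ R] {p q : R} {l : ℂ}
    (hqp : q * p = l • (p * q)) (hq : q ^ 3 = 0) (n : ℕ) :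
    ∃ s t : ℂ, ‖s‖ ≤ (1 + ‖l‖ + ‖l‖ ^ 2) ^ (n + 2) ∧ ‖t‖ ≤ (1 + ‖l‖ + ‖l‖ ^ 2) ^ (n + 2) ∧
      (p + q) ^ (n + 2) = p ^ (n + 2) + s • (p ^ (n + 1) * q) + t • (p ^ n * q ^ 2) := by
  -- The coefficients obey `s' = 1 + l s` and `t' = s + l ^ 2 t`; `K` dominates both growth factors
  -- `1 + ‖l‖` and `1 + ‖l‖ ^ 2`.
  set K : ℝ := 1 + ‖l‖ + ‖l‖ ^ 2 with hK
  have hl := norm_nonneg l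
  have hK1 : 1 ≤ K := by nlinarith
  induction n with
  | zero =>
    refine ⟨1 + l, 1, ?_, ?_, ?_⟩
    · refine (norm_add_le _ _).trans ?_
      rw [norm_one]
      have h1 : 1 + ‖l‖ ≤ K := by nlinarith [sq_nonneg ‖l‖]
      exact h1.trans (le_self_pow₀ hK1 (by norm_num))
    · rw [norm_one]
      exact one_le_pow₀ hK1
    · simp only [zero_add, pow_one, pow_zero, one_mul, one_smul, add_smul, pow_two, mul_add,
        add_mul, hqp]
      abel
  | succ n ih =>
    obtain ⟨s, t, hs, ht, h⟩ := ih
    have hK0 : 0 ≤ K ^ (n + 2) := by positivity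
    refine ⟨1 + l * s, s + l ^ 2 * t, ?_, ?_, ?_⟩
    · calc ‖1 + l * s‖ ≤ 1 + ‖l‖ * ‖s‖ := by
            simpa only [norm_one, norm_mul] using norm_add_le (1 : ℂ) (l * s)
        _ ≤ K ^ (n + 2) + ‖l‖ * K ^ (n + 2) := by
            gcongr
            exact one_le_pow₀ hK1
        _ ≤ K ^ (n + 1 + 2) := by
            rw [show n + 1 + 2 = (n + 2) + 1 from rfl, pow_succ K (n + 2), hK]
            nlinarith [mul_nonneg hK0 (sq_nonneg ‖l‖)]
    · calc ‖s + l ^ 2 * t‖ ≤ ‖s‖ + ‖l‖ ^ 2 * ‖t‖ := by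
            rw [← norm_pow, ← norm_mul]
            exact norm_add_le s (l ^ 2 * t)
        _ ≤ K ^ (n + 2) + ‖l‖ ^ 2 * K ^ (n + 2) := by gcongr
        _ ≤ K ^ (n + 1 + 2) := by
            rw [show n + 1 + 2 = (n + 2) + 1 from rfl, pow_succ K (n + 2), hK]
            nlinarith [mul_nonneg hK0 hl]
    · have h2 : q ^ 2 * p = l ^ 2 • (p * q ^ 2) := by
        rw [pow_two, mul_assoc, hqp, mul_smul_comm, ← mul_assoc, hqp, smul_mul_assoc, smul_smul,
          mul_assoc, pow_two]
      have e1 : p ^ (n + 1) * q * p = l • (p ^ (n + 2) * q) := by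
        rw [mul_assoc, hqp, mul_smul_comm, ← mul_assoc, ← pow_succ]
      have e2 : p ^ n * q ^ 2 * p = l ^ 2 • (p ^ (n + 1) * q ^ 2) := by
        rw [mul_assoc, h2, mul_smul_comm, ← mul_assoc, ← pow_succ]
      have e3 : p ^ n * q ^ 2 * q = 0 := by rw [mul_assoc, ← pow_succ, hq, mul_zero]
      have e4 : p ^ (n + 1) * q * q = p ^ (n + 1) * q ^ 2 := by rw [mul_assoc, ← pow_two]
      rw [show n + 1 + 2 = (n + 2) + 1 from rfl, pow_succ (p + q), h, mul_add, add_mul, add_mul,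
        add_mul, add_mul, smul_mul_assoc, smul_mul_assoc, smul_mul_assoc, smul_mul_assoc, e1, e2,
        e3, e4, ← pow_succ, add_smul, add_smul, one_smul, smul_smul, smul_smul, smul_zero,
        mul_comm s l, mul_comm t (l ^ 2), show n + 1 + 1 = n + 2 from rfl]
      abel

/-- If `p` is quasinilpotent, `q p = l p q` and `q ^ 3 = 0`, then `p + q` is quasinilpotent. -/
theorem IsQuasinilpotent.tendsto_add_of_mul_eq_smul {R : Type*} [NormedRing R]
    [NormedAlgebra ℂ R] [CompleteSpace R] {p q : R} {l : ℂ} (hp : IsQuasinilpotent p)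
    (hqp : q * p = l • (p * q)) (hq : q ^ 3 = 0) (r : ℝ) (hr : 0 ≤ r) :
    Tendsto (fun n : ℕ => r ^ n * ‖(p + q) ^ n‖) atTop (𝓝 0) := by
  rw [← tendsto_add_atTop_iff_nat 2]
  set K : ℝ := 1 + ‖l‖ + ‖l‖ ^ 2 with hK
  have hK0 : 0 ≤ K := by positivity
  have h1 := (hp.tendsto r hr).comp (tendsto_add_atTop_nat 2)
  have h2 := ((hp.tendsto (r * K) (by positivity)).comp
    (tendsto_add_atTop_nat 1)).const_mul (r * K * ‖q‖)
  have h3 := (hp.tendsto (r * K) (by positivity)).const_mul ((r * K) ^ 2 * ‖q ^ 2‖)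
  have h := (h1.add h2).add h3
  simp only [mul_zero, add_zero] at h
  refine squeeze_zero (fun n => by positivity) (fun n => ?_) h
  obtain ⟨s, t, hs, ht, e⟩ := exists_add_pow_eq_of_mul_eq_smul hqp hq n
  rw [e]
  calc r ^ (n + 2) * ‖p ^ (n + 2) + s • (p ^ (n + 1) * q) + t • (p ^ n * q ^ 2)‖
      ≤ r ^ (n + 2) * (‖p ^ (n + 2)‖ + K ^ (n + 2) * (‖p ^ (n + 1)‖ * ‖q‖)
          + K ^ (n + 2) * (‖p ^ n‖ * ‖q ^ 2‖)) := by
        gcongr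
        refine (norm_add₃_le).trans ?_
        rw [norm_smul, norm_smul]
        gcongr
        · exact norm_mul_le _ _
        · exact norm_mul_le _ _
    _ = _ := by
        simp only [Function.comp_apply]
        ring_nf

/-! ### The additive formula -/

/-- The g-Drazin inverse of `P + Q` when `Q P = l P Q P^π` and `Q ^ 3 = 0`. -/
theorem IsGDrazinInverse.add_of_mul_eq_smul {R : Type*} [NormedRing R] [NormedAlgebra ℂ R]
    [CompleteSpace R] {P Q p : R} {l : ℂ} (hp : IsGDrazinInverse P p)
    (hQP : Q * P = l • (P * Q * (1 - P * p))) (hQ : Q ^ 3 = 0) :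
    Summable (fun n : ℕ => p ^ (n + 2) * Q * (P + Q) ^ n) ∧
      IsGDrazinInverse (P + Q) (p + ∑' n : ℕ, p ^ (n + 2) * Q * (P + Q) ^ n) := by
  set M := P + Q with hM
  have hpp : P * p * p = p := by rw [← hp.comm]; exact hp.inner.symm
  have hee : P * p * (P * p) = P * p := by rw [← mul_assoc, mul_assoc P p P, hp.comm,
    ← mul_assoc, mul_assoc (P * P), mul_assoc P P, ← mul_assoc P p, hpp]
  have hPe : Commute P (P * p) := (Commute.refl P).mul_right (show Commute p P from hp.comm).symm
  -- Since `p = P p p`, the relation turns `Q p` into a multiple of `P Q P^π p p`, and `P^π p = 0`.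
  have hQp : Q * p = 0 := by
    calc Q * p = Q * P * (p * p) := by rw [← mul_assoc, mul_assoc Q P p, mul_assoc, hpp]
      _ = 0 := by
        rw [hQP, smul_mul_assoc, mul_assoc, ← mul_assoc (1 - P * p), sub_mul, one_mul, hpp,
          sub_self, zero_mul, mul_zero, smul_zero]
  have hQe : Q * (P * p) = 0 := by rw [← hp.comm, ← mul_assoc, hQp, zero_mul]
  set f := 1 - P * p with hf
  have hff : f * f = f := by
    rw [hf, sub_mul, mul_sub, mul_sub, hee]; simp
  have hQf : Q * f = Q := by rw [hf, mul_sub, hQe, mul_one, sub_zero]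
  have hPf : Commute P f := (Commute.one_right P).sub_right hPe
  have hfMf : f * M * f = f * M := by
    rw [hM, mul_add, add_mul, mul_assoc f Q, hQf, mul_assoc f P, hPf.eq, ← mul_assoc, hff]
  have hfpow : ∀ n, f * M ^ n = f * (f * M) ^ n := by
    intro n
    induction n with
    | zero => simp
    | succ n ih =>
      rw [pow_succ, ← mul_assoc, ih, pow_succ, ← mul_assoc f]
      have : f * (f * M) ^ n * f = f * (f * M) ^ n := by
        cases n with
        | zero => simp [hff]
        | succ n => rw [pow_succ, ← mul_assoc, mul_assoc _ (f * M) f, hfMf]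
      rw [← mul_assoc, this]
  have hQpow : ∀ n, Q * M ^ n = Q * (f * M) ^ n := by
    intro n
    rw [← hQf, mul_assoc, hfpow, ← mul_assoc, hQf]
  have hN : ∀ r : ℝ, 0 ≤ r → Tendsto (fun n : ℕ => r ^ n * ‖(f * M) ^ n‖) atTop (𝓝 0) := by
    intro r hr
    have hq : IsQuasinilpotent (f * P) := by
      convert hp.qnil using 1
      rw [hf, sub_mul, one_mul, mul_assoc, hp.comm, pow_two, mul_assoc]
    rw [hM, mul_add]
    have hfQf : f * Q * f = f * Q := by rw [mul_assoc, hQf]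
    -- After compression by `f` the factor `P^π` is absorbed, as `Q f = Q`, leaving an honest
    -- relation `(f Q)(f P) = l (f P)(f Q)`.
    refine hq.tendsto_add_of_mul_eq_smul (l := l) ?_ ?_ r hr
    · rw [← mul_assoc (f * Q), hfQf, mul_assoc f Q, hQP, mul_smul_comm, mul_assoc P Q, hQf]
      congr 1
      rw [← hPf.eq, mul_assoc, ← mul_assoc f f, hff, ← mul_assoc, ← mul_assoc, hPf.eq]
    · have : (f * Q) ^ 3 = f * Q ^ 3 := by
        rw [pow_succ, pow_two, ← mul_assoc (f * Q), hfQf, ← mul_assoc (f * Q * Q),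
          mul_assoc (f * Q) Q f, hQf, pow_succ, pow_two]
        simp only [mul_assoc]
      rw [this, hQ, mul_zero]
  have hTsum : Summable (fun n : ℕ => p ^ (n + 1) * Q * M ^ n) := by
    -- The factor 2 leaves room for the geometric majorant `(1 / 2) ^ n`.
    have hb := (hN (2 * ‖p‖) (by positivity)).eventually (eventually_lt_nhds (zero_lt_one' ℝ))
    refine Summable.of_norm_bounded_eventually_nat
      (g := fun n => ‖p‖ * ‖Q‖ * (1 / 2 : ℝ) ^ n)
      ((summable_geometric_of_lt_one (by norm_num) (by norm_num)).mul_left _) ?_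
    filter_upwards [hb] with n hn
    rw [mul_assoc, hQpow]
    calc ‖p ^ (n + 1) * (Q * (f * M) ^ n)‖ ≤ ‖p‖ ^ (n + 1) * (‖Q‖ * ‖(f * M) ^ n‖) := by
          refine (norm_mul_le _ _).trans ?_
          gcongr
          · exact norm_pow_le' p n.succ_pos
          · exact norm_mul_le _ _
      _ = ‖p‖ * ‖Q‖ * (1 / 2 : ℝ) ^ n * ((2 * ‖p‖) ^ n * ‖(f * M) ^ n‖) := by
          have : (1 / 2 : ℝ) ^ n * 2 ^ n = 1 := by rw [← mul_pow]; norm_num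
          rw [mul_pow, pow_succ]
          linear_combination (-(‖p‖ ^ n * ‖p‖ * ‖Q‖ * ‖(f * M) ^ n‖)) * this
      _ ≤ ‖p‖ * ‖Q‖ * (1 / 2 : ℝ) ^ n := mul_le_of_le_one_right (by positivity) hn.le
  set T := ∑' n : ℕ, p ^ (n + 1) * Q * M ^ n with hT
  have hS : HasSum (fun n : ℕ => p ^ (n + 2) * Q * M ^ n) (p * T) := by
    have h : ∀ n, p ^ (n + 2) * Q * M ^ n = p * (p ^ (n + 1) * Q * M ^ n) := fun n => by
      rw [pow_succ' p (n + 1)]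
      simp only [mul_assoc]
    simp only [h]
    exact hTsum.hasSum.mul_left p
  have hTrec : T = p * Q + p * T * M := by
    rw [← (hS.mul_right M).tsum_eq]
    refine hTsum.tsum_eq_zero_add.trans ?_
    simp only [zero_add, pow_zero, one_mul, mul_one, pow_succ, mul_assoc]
  have hTp : T * p = 0 := by
    have hMp : ∀ n, M ^ n * p = p * P ^ n := by
      intro n
      induction n with
      | zero => simp
      | succ n ih =>
        rw [pow_succ, mul_assoc, hM, add_mul, hQp, add_zero, ← hp.comm, ← mul_assoc, ← hM, ih,
          mul_assoc, ← pow_succ]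
    rw [← (hTsum.hasSum.mul_right p).tsum_eq]
    convert tsum_zero with n
    rw [mul_assoc, hMp, mul_assoc, ← mul_assoc Q, hQp, zero_mul, mul_zero]
  have hTp' : T = p * (Q + T * M) := by rw [mul_add, ← mul_assoc, ← hTrec]
  have heT : P * p * T = T := by
    conv_lhs => rw [hTp', ← mul_assoc, hpp, ← hTp']
  have hTe : T * (P * p) = 0 := by rw [← hp.comm, ← mul_assoc, hTp, zero_mul]
  have hMb : M * (p + p * T) = P * p + T := by
    rw [hM, mul_add, add_mul, add_mul, hQp, ← mul_assoc, ← mul_assoc, hQp, heT, zero_mul,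
      add_zero, add_zero]
  have hbM : (p + p * T) * M = P * p + T := by
    rw [add_mul]
    conv_lhs => rw [hM, mul_add, ← hM, add_assoc, ← hTrec, hp.comm]
  refine ⟨hS.summable, ?_⟩
  rw [hS.tsum_eq]
  refine ⟨hbM.trans hMb.symm, ?_, ?_⟩
  · rw [hbM, add_mul, mul_add, mul_add, hpp, hTp, ← mul_assoc, ← mul_assoc, hpp, hTp, zero_mul,
      add_zero, add_zero]
  · set g := 1 - (P * p + T) with hg
    have hMg : M - M ^ 2 * (p + p * T) = M * g := by
      rw [pow_two, mul_assoc, hMb, hg, mul_sub, mul_one]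
    have hcomm : Commute M g := by
      refine (Commute.one_right M).sub_right ?_
      rw [← hMb]
      exact (Commute.refl M).mul_right (hMb.trans hbM.symm)
    have hgf : g * f = g := by
      rw [hf, mul_sub, mul_one, hg, sub_mul, one_mul, add_mul, hee, hTe, add_zero, sub_self,
        sub_zero]
    have hTT : T * T = 0 := by
      conv_lhs => rw [hTp', ← hTp', hTp', ← mul_assoc, ← hTp', hTp, zero_mul]
    have hgg : IsIdempotentElem g := by
      apply IsIdempotentElem.one_sub
      change (P * p + T) * (P * p + T) = P * p + T
      rw [add_mul, mul_add, mul_add, hee, heT, hTe, hTT, add_zero, add_zero]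
    rw [hMg]
    refine IsQuasinilpotent.of_tendsto fun r hr => ?_
    have h := (hN r hr).const_mul ‖g‖
    rw [mul_zero] at h
    refine squeeze_zero' (Eventually.of_forall fun n => by positivity) ?_ h
    filter_upwards [eventually_gt_atTop 0] with n hn
    -- The idempotent `g` commutes with `M` and satisfies `g f = g`, so the decay of `(f M) ^ n`
    -- carries over.
    have : (M * g) ^ n = g * (f * M) ^ n := by
      rw [hcomm.mul_pow, hgg.pow_eq hn.ne', (hcomm.pow_left n).eq, ← hgf, mul_assoc, hfpow,
        ← mul_assoc, hgf]
    rw [this]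
    calc r ^ n * ‖g * (f * M) ^ n‖ ≤ r ^ n * (‖g‖ * ‖(f * M) ^ n‖) := by
          gcongr
          exact norm_mul_le _ _
      _ = ‖g‖ * (r ^ n * ‖(f * M) ^ n‖) := by
          rw [mul_left_comm]

-- Transfer to 2 × 2 matrices

attribute [local instance] Matrix.linftyOpNormedRing Matrix.linftyOpNormedAlgebra

theorem completeSpace_matrix_linftyOp {𝒜 : Type*} [NormedRing 𝒜] [CompleteSpace 𝒜] :
    @CompleteSpace (Matrix (Fin 2) (Fin 2) 𝒜)
      (Matrix.linftyOpNormedRing (n := Fin 2) (α := 𝒜)).toPseudoMetricSpace.toUniformSpace :=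
  inferInstanceAs (CompleteSpace (Fin 2 → Fin 2 → 𝒜))

attribute [local instance] completeSpace_matrix_linftyOp

theorem norm_diag_le {𝒜 : Type*} [NormedRing 𝒜] (a d : 𝒜) :
    ‖!![a, 0; 0, d]‖ ≤ ‖a‖ + ‖d‖ := by
  have ha := norm_nonneg a
  have hd := norm_nonneg d
  refine (Matrix.linfty_opNorm_def (α := 𝒜) !![a, 0; 0, d]).trans_le ?_
  rw [← coe_nnnorm a, ← coe_nnnorm d, ← NNReal.coe_add, NNReal.coe_le_coe]
  refine Finset.sup_le fun i _ => ?_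
  fin_cases i <;> simp

theorem diag_pow {𝒜 : Type*} [Ring 𝒜] (a d : 𝒜) (n : ℕ) :
    !![a, 0; 0, d] ^ n = !![a ^ n, 0; 0, d ^ n] := by
  induction n with
  | zero => simp [Matrix.one_fin_two]
  | succ n ih => simp [pow_succ, ih]

/-- Matrices commuting with a diagonal one need not be diagonal, so the definition does not pass to
entries directly; the decay of powers does. -/
theorem IsQuasinilpotent.diag {𝒜 : Type*} [NormedRing 𝒜] [NormedAlgebra ℂ 𝒜]
    [CompleteSpace 𝒜] {a d : 𝒜} (ha : IsQuasinilpotent a) (hd : IsQuasinilpotent d) :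
    IsQuasinilpotent !![a, 0; 0, d] := by
  refine IsQuasinilpotent.of_tendsto fun r hr => ?_
  have h := (ha.tendsto r hr).add (hd.tendsto r hr)
  rw [add_zero] at h
  refine squeeze_zero (fun n => by positivity) (fun n => ?_) h
  rw [diag_pow, ← mul_add]
  gcongr
  exact norm_diag_le _ _

theorem IsGDrazinInverse.diag {𝒜 : Type*} [NormedRing 𝒜] [NormedAlgebra ℂ 𝒜]
    [CompleteSpace 𝒜] {A D a d : 𝒜} (ha : IsGDrazinInverse A a) (hd : IsGDrazinInverse D d) :
    IsGDrazinInverse !![A, 0; 0, D] !![a, 0; 0, d] := by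
  refine ⟨?_, ?_, ?_⟩
  · simp [ha.comm, hd.comm]
  · simp [← ha.inner, ← hd.inner]
  · convert ha.qnil.diag hd.qnil using 1
    rw [diag_pow, Matrix.mul_fin_two]
    ext i j
    fin_cases i <;> fin_cases j <;> simp

theorem corollary3p2 {𝒜 : Type*} [NormedRing 𝒜] [NormedAlgebra ℂ 𝒜] [CompleteSpace 𝒜]
    (A B C D : 𝒜) (lam : ℂ) (hlam : lam ≠ 0)
    (hA : IsGDrazinInvertible A) (hD : IsGDrazinInvertible D)
    (hBD : B * D = lam • (A * B * spectralIdem D))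
    (hCA : C * A = lam • (D * C * spectralIdem A))
    (hBC : B * C = 0)
    (M P Q : Matrix (Fin 2) (Fin 2) 𝒜)
    (hM : M = !![A, B; C, D]) (hP : P = !![A, 0; 0, D]) (hQ : Q = !![0, B; C, 0]) :
    IsGDrazinInvertible P ∧ IsGDrazinInvertible M ∧
      Summable (fun n : ℕ => gDrazinInv P ^ (n + 2) * Q * M ^ n) ∧
      gDrazinInv M = !![gDrazinInv A, 0; 0, gDrazinInv D] +
        ∑' n : ℕ, gDrazinInv P ^ (n + 2) * Q * M ^ n := by
  subst hM hP hQ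
  have hA' := isGDrazinInverse_gDrazinInv hA
  have hD' := isGDrazinInverse_gDrazinInv hD
  have hP' := hA'.diag hD'
  have hP'' : IsGDrazinInvertible !![A, 0; 0, D] := ⟨_, hP'⟩
  have hPe := (isGDrazinInverse_gDrazinInv hP'').unique hP'
  have hMPQ : !![A, B; C, D] = !![A, 0; 0, D] + !![0, B; C, 0] := by
    ext i j
    fin_cases i <;> fin_cases j <;> simp
  have hQP : !![0, B; C, 0] * !![A, 0; 0, D] = lam • (!![A, 0; 0, D] * !![0, B; C, 0] *
      (1 - !![A, 0; 0, D] * !![gDrazinInv A, 0; 0, gDrazinInv D])) := by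
    simp only [spectralIdem] at hBD hCA
    ext i j
    fin_cases i <;> fin_cases j <;>
      simp [Matrix.one_fin_two, hBD, hCA]
  -- The only possibly nonzero entries of the cube are `B C B` and `C B C`, both killed by `B C =
  -- 0`.
  have hQ : !![0, B; C, 0] ^ 3 = 0 := by
    ext i j
    fin_cases i <;> fin_cases j <;> simp [pow_succ, mul_assoc, hBC]
  obtain ⟨hs, hM⟩ := hP'.add_of_mul_eq_smul hQP hQ
  rw [← hMPQ] at hs hM
  have hM' : IsGDrazinInvertible !![A, B; C, D] := ⟨_, hM⟩
  rw [hPe]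
  exact ⟨hP'', hM', hs, (isGDrazinInverse_gDrazinInv hM').unique hM⟩
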